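/- For probability measures $F,G$ on $\mathbb{R}$, identified with their cumulative distribution functions, let $d_{CvM}(F,G)=\int_{-\infty}^{\infty}(F(t)-G(t))^2\,G(dt)$ be the Cramér–von Mises distance. For $a>0$ and a probability measure $H$ on $\mathbb{R}$, $DP(a,H)$ denotes the Dirichlet process: the law of a random probability measure $P$ such that, for every finite measurable partition $A_1,\dots,A_k$ of $\mathbb{R}$ with $k\ge 2$, $(P(A_1),\dots,P(A_k))\sim\mathrm{Dirichlet}(aH(A_1),\dots,aH(A_k))$, where coordinates with parameter $0$ vanish almost surely. Let $x_1,x_2,\dots$ be i.i.d. with continuous cdf $F$ and let $y_1,y_2,\dots$ be i.i.d. with continuous cdf $G$, the two sequences being independent. Let $a_1,a_2>0$ and let $H_1,H_2$ be probability measures on $\mathbb{R}$. Let $P_{x}=P_{x}^{(n_1)}$ be the posterior process for the prior $DP(a_1,H_1)$ given $x=(x_1,\dots,x_{n_1})$, that is, a random probability measure whose conditional law given $x$ is $$DP(a_1+n_1,H_{x}),\qquad H_{x}=\frac{a_1}{a_1+n_1}H_1+\frac{1}{a_1+n_1}\sum_{i=1}^{n_1}\delta_{x_i},$$ and let $Q_{y}=Q_{y}^{(n_2)}$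 be likewise the posterior process for the prior $DP(a_2,H_2)$ given $y=(y_1,\dots,y_{n_2})$. All these variables are defined on one probability space; otherwise the joint law of the processes $P_x^{(n_1)}$, $Q_y^{(n_2)}$ ($n_1,n_2\ge 0$) is arbitrary. Then, almost surely, $$d_{CvM}\bigl(P_{x}^{(n_1)},Q_{y}^{(n_2)}\bigr)\longrightarrow d_{CvM}(F,G)\qquad\text{as } n_1,n_2\to\infty .$$ -/

import Mathlib

open MeasureTheory ProbabilityTheory Filter Topology

noncomputable section

/-- The `Gamma(α, 1)` law for `α > 0`, with the usual convention that `Gamma(0, 1)` is the point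
mass at `0`. -/
def gammaLaw (α : ℝ) : Measure ℝ :=
  if 0 < α then gammaMeasure α 1 else Measure.dirac 0

/-- The Dirichlet distribution with nonnegative parameters `α i`, not all of them zero: the law of
`(Z i / ∑ j, Z j)_i`, where the `Z i` are independent and `Z i ∼ Gamma(α i, 1)`.
A coordinate with parameter `0` vanishes almost surely. -/
def dirichletLaw {ι : Type*} [Fintype ι] (α : ι → ℝ) : Measure (ι → ℝ) :=
  (Measure.pi fun i => gammaLaw (α i)).map fun z i => z i / ∑ j, z j

/-- `𝔓`, a law on the space of probability measures on `S`, is the law `DP(a, H)` of the Dirichlet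
process with concentration parameter `a` and base measure `H`: for every finite measurable
partition `A` of `S` into `k ≥ 2` sets, the vector `(P (A 1), …, P (A k))`, with `P ∼ 𝔓`, has the
Dirichlet distribution with parameters `(a * H (A 1), …, a * H (A k))`. -/
def IsDirichletProcessLaw {S : Type*} [MeasurableSpace S] (a : ℝ) (H : Measure S)
    (𝔓 : Measure (ProbabilityMeasure S)) : Prop :=
  ∀ (k : ℕ), 2 ≤ k → ∀ A : Fin k → Set S, (∀ i, MeasurableSet (A i)) →
    Pairwise (fun i j => Disjoint (A i) (A j)) → (⋃ i, A i) = Set.univ →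
      𝔓.map (fun (P : ProbabilityMeasure S) i => (P : Measure S).real (A i)) =
        dirichletLaw fun i => a * H.real (A i)

/-- The empirical measure `n⁻¹ ∑ i, δ_{x i}` of a sample `x` of size `n`
(the zero measure if `n = 0`). -/
def empiricalMeasure {S : Type*} [MeasurableSpace S] {n : ℕ} (x : Fin n → S) : Measure S :=
  (n : ENNReal)⁻¹ • ∑ i, Measure.dirac (x i)

/-- The base measure `H_x = a (a + n)⁻¹ H + n (a + n)⁻¹ F_n` of the Dirichlet process posterior,
where `F_n` is the empirical measure of the sample `x` of size `n`. -/
def posteriorBase {S : Type*} [MeasurableSpace S] (a : ℝ) (H : Measure S) {n : ℕ}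
    (x : Fin n → S) : Measure S :=
  ENNReal.ofReal (a / (a + n)) • H + ENNReal.ofReal (n / (a + n)) • empiricalMeasure x

/-- The random probability measure `P` is a posterior process `P_x`, given the sample `x` of size
`n`, for the Dirichlet process prior `DP(a, H)`: conditionally on `x`, the law of `P` is
`DP(a + n, H_x)`. -/
def IsDirichletPosterior {Ω S : Type*} [MeasurableSpace Ω] [MeasurableSpace S] (a : ℝ)
    (H : Measure S) {n : ℕ} (x : Ω → Fin n → S) (P : Ω → ProbabilityMeasure S)
    (μ : Measure Ω) : Prop :=
  ∃ κ : Kernel (Fin n → S) (ProbabilityMeasure S), IsMarkovKernel κ ∧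
    (∀ᵐ v ∂(μ.map x), IsDirichletProcessLaw (a + n) (posteriorBase a H v) (κ v)) ∧
    HasCondDistrib P x κ μ

/-- The Cramér–von Mises distance `∫ (F(t) - G(t))² G(dt)` between two probability measures on the
real line, `F(t)` and `G(t)` being their cumulative distribution functions. -/
def cvmDist (F G : Measure ℝ) : ℝ :=
  ∫ t, (cdf F t - cdf G t) ^ 2 ∂G

end

/-!
The proof reduces almost sure convergence of the Cramér–von Mises distance to almost sure
convergence of the two random distribution functions at every rational point.

Fix a measurable set `A`. Given a sample of size `n`, the mass `P_x(A)` has the law of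
`Z₀ / (Z₀ + Z₁)` for independent gamma variables whose parameters have the sum `N = a + n` and the
quotient of the first by `N` equal to `H_x(A)`. The fourth central moment of a gamma variable with
parameter at most `N` is of order `N²`, so `|P_x(A) - H_x(A)| ≥ ε` has probability at most
`C(ε) / n²`, uniformly in the sample (`IsDirichletPosterior.tail_le`). This bound is summable,
and by the first Borel–Cantelli lemma `P_x(A) - H_x(A) → 0` almost surely
(`IsDirichletPosterior.ae_tendsto_sub`); no assumption on the joint law of the processes enters.
The strong law of large numbers gives `H_x(A) → F(A)` (`ae_tendsto_posteriorBase`).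

Hence, almost surely, the distribution functions of `P_x` and `Q_y` converge at every rational to
those of `F` and `G`. As the limits are continuous, the convergence is uniform
(`tendstoUniformly_cdf`), and `Q_y → G` weakly (`tendsto_of_tendsto_cdf_rat`). So the distance
differs little from `∫ (F - G)² dQ_y`, which tends to `∫ (F - G)² dG` because `(F - G)²` is bounded
and continuous (`tendsto_cvmDist`). The last step is deterministic and works along any countably
generated filter, in particular along pairs of indices.
-/

/-! ### Gamma and Dirichlet distributions -/

theorem integrable_pow_gammaMeasure {α : ℝ} (hα : 0 < α) (k : ℕ) :
    Integrable (fun x : ℝ => x ^ k) (gammaMeasure α 1) ∧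
      ∫ x, x ^ k ∂gammaMeasure α 1 = Real.Gamma (α + k) / Real.Gamma α := by
  have hk : 0 < α + k := by positivity
  have hΓ := Real.Gamma_pos_of_pos hα
  have key : (fun x => gammaPDFReal α 1 x * x ^ k) =ᵐ[volume] (Set.Ioi (0 : ℝ)).indicator
      fun x => (Real.Gamma α)⁻¹ * (x ^ (α + k - 1) * Real.exp (-(1 * x))) := by
    filter_upwards [Measure.ae_ne volume (0 : ℝ)] with x hx
    rcases lt_or_gt_of_ne hx with hx | hx
    · rw [Set.indicator_of_notMem (by simpa using hx.le), gammaPDFReal, if_neg hx.not_ge, zero_mul]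
    · rw [Set.indicator_of_mem (by simpa using hx), gammaPDFReal, if_pos hx.le,
        show α + k - 1 = (α - 1) + (k : ℝ) by ring, Real.rpow_add hx, Real.rpow_natCast]
      simp
      ring
  have hint : IntegrableOn (fun x : ℝ => x ^ (α + k - 1) * Real.exp (-(1 * x))) (Set.Ioi 0) := by
    have := integrableOn_rpow_mul_exp_neg_mul_rpow (p := 1) (s := α + k - 1) (b := 1)
      (by linarith) one_pos one_pos
    simpa using this
  have hpdf : gammaMeasure α 1 = volume.withDensity fun x =>
      ((gammaPDFReal α 1 x).toNNReal : ENNReal) := rfl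
  have hm : Measurable fun x => (gammaPDFReal α 1 x).toNNReal :=
    (measurable_gammaPDFReal α 1).real_toNNReal
  have hsmul : (fun x : ℝ => (gammaPDFReal α 1 x).toNNReal • x ^ k)
      = fun x => gammaPDFReal α 1 x * x ^ k := by
    ext x
    rw [NNReal.smul_def, Real.coe_toNNReal _ (gammaPDFReal_nonneg hα one_pos x), smul_eq_mul]
  constructor
  · rw [hpdf, integrable_withDensity_iff_integrable_smul hm, hsmul, integrable_congr key,
      integrable_indicator_iff measurableSet_Ioi]
    exact hint.const_mul _
  · rw [hpdf, integral_withDensity_eq_integral_smul hm, hsmul, integral_congr_ae key,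
      integral_indicator measurableSet_Ioi, integral_const_mul,
      Real.integral_rpow_mul_exp_neg_mul_Ioi hk one_pos]
    simp
    ring

theorem integral_sub_pow_four_gammaMeasure {α : ℝ} (hα : 0 < α) :
    Integrable (fun x : ℝ => (x - α) ^ 4) (gammaMeasure α 1) ∧
      ∫ x, (x - α) ^ 4 ∂gammaMeasure α 1 = 3 * α ^ 2 + 6 * α := by
  have h := fun k => integrable_pow_gammaMeasure hα k
  have hΓ := (Real.Gamma_pos_of_pos hα).ne'
  have e : (fun x : ℝ => (x - α) ^ 4) = fun x => x ^ 4 + (-4 * α) * x ^ 3 + (6 * α ^ 2) * x ^ 2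
      + (-4 * α ^ 3) * x ^ 1 + α ^ 4 * x ^ 0 := by ext x; ring
  have i4 := (h 4).1
  have i3 := (h 3).1.const_mul (-4 * α)
  have i2 := (h 2).1.const_mul (6 * α ^ 2)
  have i1 := (h 1).1.const_mul (-4 * α ^ 3)
  have i0 := (h 0).1.const_mul (α ^ 4)
  have i43 : Integrable (fun x : ℝ => x ^ 4 + (-4 * α) * x ^ 3) (gammaMeasure α 1) := i4.add i3
  have i42 : Integrable (fun x : ℝ => x ^ 4 + (-4 * α) * x ^ 3 + (6 * α ^ 2) * x ^ 2)
    (gammaMeasure α 1) := i43.add i2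
  have i41 : Integrable (fun x : ℝ => x ^ 4 + (-4 * α) * x ^ 3 + (6 * α ^ 2) * x ^ 2
    + (-4 * α ^ 3) * x ^ 1) (gammaMeasure α 1) := i42.add i1
  refine ⟨by rw [e]; exact i41.add i0, ?_⟩
  rw [e, integral_add i41 i0, integral_add i42 i1, integral_add i43 i2, integral_add i4 i3]
  simp only [integral_const_mul, (h _).2]
  have g1 : Real.Gamma (α + 1) = α * Real.Gamma α := Real.Gamma_add_one hα.ne'
  have g2 : Real.Gamma (α + 2) = (α + 1) * (α * Real.Gamma α) := by
    rw [← g1, ← Real.Gamma_add_one (by positivity)]; ring_nf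
  have g3 : Real.Gamma (α + 3) = (α + 2) * ((α + 1) * (α * Real.Gamma α)) := by
    rw [← g2, ← Real.Gamma_add_one (by positivity)]; ring_nf
  have g4 : Real.Gamma (α + 4) = (α + 3) * ((α + 2) * ((α + 1) * (α * Real.Gamma α))) := by
    rw [← g3, ← Real.Gamma_add_one (by positivity)]; ring_nf
  norm_num [g1, g2, g3, g4]
  field_simp
  ring

instance isProbabilityMeasure_gammaLaw (α : ℝ) : IsProbabilityMeasure (gammaLaw α) := by
  unfold gammaLaw
  split_ifs with h
  · exact isProbabilityMeasure_gammaMeasure h one_pos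
  · infer_instance

/-- Chebyshev's inequality with the fourth central moment `3 α² + 6 α ≤ 9 N²`. The second moment
would only give a bound of order `1 / N`, which is not summable. -/
theorem gammaLaw_tail_le {α N δ : ℝ} (hα : 0 ≤ α) (hαN : α ≤ N) (hN : 1 ≤ N) (hδ : 0 < δ) :
    (gammaLaw α).real {z | δ * N ≤ |z - α|} ≤ 9 / (δ ^ 4 * N ^ 2) := by
  have hN0 : 0 < N := by linarith
  have hδN : 0 < δ * N := by positivity
  rcases hα.eq_or_lt with rfl | hα
  · rw [gammaLaw, if_neg (lt_irrefl _), measureReal_def, Measure.dirac_apply' _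
      (measurableSet_le measurable_const (by fun_prop)), Set.indicator_of_notMem (by simpa using hδN)]
    simp only [ENNReal.toReal_zero]
    positivity
  · rw [gammaLaw, if_pos hα]
    obtain ⟨hi, he⟩ := integral_sub_pow_four_gammaMeasure hα
    have hM := mul_meas_ge_le_integral_of_nonneg
      (ae_of_all _ fun x => by positivity) hi ((δ * N) ^ 4)
    have hset : {z | δ * N ≤ |z - α|} = {x : ℝ | (δ * N) ^ 4 ≤ (x - α) ^ 4} := by
      ext z
      have : (z - α) ^ 4 = |z - α| ^ 4 := (Even.pow_abs (by decide) _).symm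
      simp only [Set.mem_ofPred_eq, this]
      exact (pow_le_pow_iff_left₀ hδN.le (abs_nonneg _) (by norm_num)).symm
    rw [hset, le_div_iff₀ (by positivity)]
    rw [he] at hM
    have : 3 * α ^ 2 + 6 * α ≤ 9 * N ^ 2 := by nlinarith
    have h2 := hM.trans this
    refine le_of_mul_le_mul_right ?_ (show 0 < N ^ 2 by positivity)
    linarith [mul_pow δ N 4, show (gammaMeasure α 1).real {x : ℝ | (δ * N) ^ 4 ≤ (x - α) ^ 4}
      * (δ ^ 4 * N ^ 2) * N ^ 2 = (δ * N) ^ 4 *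
      (gammaMeasure α 1).real {x : ℝ | (δ * N) ^ 4 ≤ (x - α) ^ 4} by ring]

/-- Stability of normalisation: if `z₀`, `z₁` are within `δ N` of `α₀`, `α₁`, where `N = α₀ + α₁`,
then `z₀ / (z₀ + z₁)` is within `δ / (1 - 2 δ)` of `α₀ / N`. The bound is stated for
`δ = ε / (1 + 2 ε)`, which makes it `ε`. -/
theorem abs_div_sub_div_lt {z₀ z₁ α₀ α₁ N ε : ℝ} (hα₀ : 0 ≤ α₀) (hα₁ : 0 ≤ α₁)
    (hN : α₀ + α₁ = N) (hN0 : 0 < N) (hε : 0 < ε)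
    (h₀ : |z₀ - α₀| < ε / (1 + 2 * ε) * N) (h₁ : |z₁ - α₁| < ε / (1 + 2 * ε) * N) :
    |z₀ / (z₀ + z₁) - α₀ / N| < ε := by
  obtain ⟨δ, hδ⟩ : ∃ δ, ε / (1 + 2 * ε) = δ := ⟨_, rfl⟩
  rw [hδ] at h₀ h₁
  have hδε : δ = ε * (1 - 2 * δ) := by rw [← hδ]; field_simp; ring
  have hδ0 : 0 < δ := by rw [← hδ]; positivity
  have hd : 0 < 1 - 2 * δ := by
    by_contra! h
    nlinarith
  rw [abs_lt] at h₀ h₁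
  have hz : (1 - 2 * δ) * N < z₀ + z₁ := by nlinarith
  have hz0 : 0 < z₀ + z₁ := lt_trans (by positivity) hz
  have e : z₀ / (z₀ + z₁) - α₀ / N
      = (α₁ * (z₀ - α₀) - α₀ * (z₁ - α₁)) / (N * (z₀ + z₁)) := by
    field_simp
    rw [← hN]; ring
  have hnum : |α₁ * (z₀ - α₀) - α₀ * (z₁ - α₁)| ≤ N * (δ * N) := by
    rw [abs_le, ← hN]
    rw [← hN] at h₀ h₁
    constructor <;> nlinarith
  rw [e, abs_div, abs_of_pos (by positivity : 0 < N * (z₀ + z₁)), div_lt_iff₀ (by positivity)]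
  refine hnum.trans_lt ?_
  have : δ * N < ε * (z₀ + z₁) := by nlinarith
  nlinarith

/-- Concentration of the two-dimensional Dirichlet distribution around its mean, at a rate summable
in the total mass `N` of the parameters. -/
theorem dirichletLaw_two_tail_le {α : Fin 2 → ℝ} (hα : ∀ i, 0 ≤ α i) {N ε : ℝ}
    (hN : α 0 + α 1 = N) (hN1 : 1 ≤ N) (hε : 0 < ε) :
    (dirichletLaw α).real {w | ε ≤ |w 0 - α 0 / N|} ≤
      18 / ((ε / (1 + 2 * ε)) ^ 4 * N ^ 2) := by
  obtain ⟨δ, hδ⟩ : ∃ δ, ε / (1 + 2 * ε) = δ := ⟨_, rfl⟩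
  have hδ0 : 0 < δ := by rw [← hδ]; positivity
  have hS : MeasurableSet {w : Fin 2 → ℝ | ε ≤ |w 0 - α 0 / N|} :=
    measurableSet_le measurable_const (by fun_prop)
  have hT : ∀ i, MeasurableSet {z : ℝ | δ * N ≤ |z - α i|} := fun i =>
    measurableSet_le measurable_const (by fun_prop)
  have hα' : ∀ i, α i ≤ N := by
    intro i
    have h0 := hα 0
    have h1 := hα 1
    fin_cases i <;> simp <;> linarith
  rw [dirichletLaw, map_measureReal_apply (by fun_prop) hS]
  have hsub : (fun (z : Fin 2 → ℝ) i => z i / ∑ j, z j) ⁻¹' {w | ε ≤ |w 0 - α 0 / N|} ⊆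
      ((fun z => z 0) ⁻¹' {z : ℝ | δ * N ≤ |z - α 0|}) ∪
      ((fun z => z 1) ⁻¹' {z : ℝ | δ * N ≤ |z - α 1|}) := by
    intro z hz
    by_contra hcon
    simp only [Set.mem_union, Set.mem_preimage, Set.mem_ofPred_eq, not_or, not_le] at hcon
    simp only [Set.mem_preimage, Set.mem_ofPred_eq, Fin.sum_univ_two] at hz
    refine absurd (abs_div_sub_div_lt (hα 0) (hα 1) hN (by linarith) hε ?_ ?_) hz.not_gt
    · rw [hδ]; exact hcon.1
    · rw [hδ]; exact hcon.2
  have hev : ∀ i, (Measure.pi fun i => gammaLaw (α i)).real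
      ((fun z => z i) ⁻¹' {z : ℝ | δ * N ≤ |z - α i|}) ≤ 9 / (δ ^ 4 * N ^ 2) := by
    intro i
    rw [(measurePreserving_eval (fun i => gammaLaw (α i)) i).measureReal_preimage
      (hT i).nullMeasurableSet]
    exact gammaLaw_tail_le (hα i) (hα' i) hN1 hδ0
  refine (measureReal_mono hsub).trans ((measureReal_union_le _ _).trans ?_)
  rw [hδ, show (18 : ℝ) / (δ ^ 4 * N ^ 2) = 9 / (δ ^ 4 * N ^ 2) + 9 / (δ ^ 4 * N ^ 2) by ring]
  exact add_le_add (hev 0) (hev 1)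

/-! ### Dirichlet processes and posteriors -/

theorem measurable_probabilityMeasure_real {S : Type*} [MeasurableSpace S] {A : Set S}
    (hA : MeasurableSet A) :
    Measurable fun P : ProbabilityMeasure S => (P : Measure S).real A :=
  ((Measure.measurable_coe hA).comp measurable_subtype_coe).ennreal_toReal

/-- A Dirichlet process with concentration `N` puts mass close to `H A` on `A`: this is
`dirichletLaw_two_tail_le` for the partition `{A, Aᶜ}`. -/
theorem IsDirichletProcessLaw.tail_le {S : Type*} [MeasurableSpace S] {N : ℝ} (hN : 1 ≤ N)
    {H : Measure S} [IsProbabilityMeasure H] {𝔓 : Measure (ProbabilityMeasure S)}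
    (h𝔓 : IsDirichletProcessLaw N H 𝔓) {A : Set S} (hA : MeasurableSet A)
    {ε : ℝ} (hε : 0 < ε) :
    𝔓.real {P | ε ≤ |(P : Measure S).real A - H.real A|} ≤
      18 / ((ε / (1 + 2 * ε)) ^ 4 * N ^ 2) := by
  have hm : ∀ i, MeasurableSet ((![A, Aᶜ] : Fin 2 → Set S) i) := by
    intro i; fin_cases i
    · exact hA
    · exact hA.compl
  have h := h𝔓 2 le_rfl ![A, Aᶜ] hm ?_ ?_
  · have hmap : Measurable fun (P : ProbabilityMeasure S) i =>
        (P : Measure S).real ((![A, Aᶜ] : Fin 2 → Set S) i) :=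
      measurable_pi_lambda _ fun i => measurable_probabilityMeasure_real (hm i)
    have hsum : N * H.real ((![A, Aᶜ] : Fin 2 → Set S) 0)
        + N * H.real ((![A, Aᶜ] : Fin 2 → Set S) 1) = N := by
      simp only [Matrix.cons_val_zero, Matrix.cons_val_one]
      rw [probReal_compl_eq_one_sub hA]; ring
    have key := dirichletLaw_two_tail_le
      (α := fun i => N * H.real ((![A, Aᶜ] : Fin 2 → Set S) i))
      (fun i => by positivity) hsum hN hε
    rw [← h, map_measureReal_apply hmap (measurableSet_le measurable_const (by fun_prop))] at key
    have hN0 : N ≠ 0 := by positivity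
    simpa [mul_div_cancel_left₀ _ hN0] using key
  · intro i j hij
    fin_cases i <;> fin_cases j
    · exact absurd rfl hij
    · exact disjoint_compl_right
    · exact disjoint_compl_left
    · exact absurd rfl hij
  · rw [Set.iUnion_eq_univ_iff]
    intro x
    by_cases hx : x ∈ A
    · exact ⟨0, hx⟩
    · exact ⟨1, hx⟩

theorem empiricalMeasure_real_apply {S : Type*} [MeasurableSpace S] {n : ℕ} (x : Fin n → S)
    {A : Set S} (hA : MeasurableSet A) :
    (empiricalMeasure x).real A = (n : ℝ)⁻¹ * ∑ i, A.indicator (fun _ => (1 : ℝ)) (x i) := by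
  rw [empiricalMeasure, measureReal_ennreal_smul_apply, measureReal_def,
    Measure.finsetSum_apply, ENNReal.toReal_sum (by simp)]
  congr 1
  · simp
  · refine Finset.sum_congr rfl fun i _ => ?_
    rw [Measure.dirac_apply' _ hA]
    by_cases h : x i ∈ A <;> simp [h]

theorem posteriorBase_real_apply {S : Type*} [MeasurableSpace S] {a : ℝ} (ha : 0 < a)
    (H : Measure S) [IsProbabilityMeasure H] {n : ℕ} (x : Fin n → S) {A : Set S} (hA : MeasurableSet A) :
    (posteriorBase a H x).real A =
      (a * H.real A + ∑ i, A.indicator (fun _ => (1 : ℝ)) (x i)) / (a + n) := by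
  -- For `n = 0` the factor `(n : ENNReal)⁻¹` is infinite, but the sum it multiplies is zero.
  have hE : (empiricalMeasure x) A ≠ ⊤ := by
    rcases n.eq_zero_or_pos with rfl | hn
    · simp [empiricalMeasure]
    · simp only [empiricalMeasure, Measure.smul_apply, smul_eq_mul, Measure.finsetSum_apply]
      refine ENNReal.mul_ne_top (by simp [hn.ne']) (ENNReal.sum_ne_top.2 fun i _ => ?_)
      exact measure_ne_top _ _
  rw [posteriorBase, measureReal_add_apply (by simp [ENNReal.mul_ne_top])
    (by simpa using ENNReal.mul_ne_top ENNReal.ofReal_ne_top hE),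
    measureReal_ennreal_smul_apply, measureReal_ennreal_smul_apply,
    empiricalMeasure_real_apply x hA, ENNReal.toReal_ofReal (by positivity),
    ENNReal.toReal_ofReal (by positivity)]
  rcases n.eq_zero_or_pos with rfl | hn
  · simp; ring
  · field_simp

/-- This includes `n = 0`, where the empirical measure vanishes but has weight `0`. -/
theorem isProbabilityMeasure_posteriorBase {S : Type*} [MeasurableSpace S] {a : ℝ}
    (ha : 0 < a) (H : Measure S) [IsProbabilityMeasure H] {n : ℕ} (x : Fin n → S) :
    IsProbabilityMeasure (posteriorBase a H x) := by
  rw [isProbabilityMeasure_iff_real, posteriorBase_real_apply ha H x MeasurableSet.univ]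
  have : a + n ≠ 0 := by positivity
  simp [this]

/-- The conditional concentration bound does not depend on the sample, so it holds
unconditionally. -/
theorem IsDirichletPosterior.tail_le {S Ω : Type*} [MeasurableSpace S] [MeasurableSpace Ω]
    {μ : Measure Ω}
    [IsProbabilityMeasure μ] {a : ℝ} (ha : 0 < a) {H : Measure S} [IsProbabilityMeasure H]
    {n : ℕ} (hn : 1 ≤ n) {x : Ω → Fin n → S} {P : Ω → ProbabilityMeasure S}
    (hP : IsDirichletPosterior a H x P μ) {A : Set S} (hA : MeasurableSet A)
    {ε : ℝ} (hε : 0 < ε) :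
    μ {ω | ε ≤ |(P ω : Measure S).real A - (posteriorBase a H (x ω)).real A|} ≤
      ENNReal.ofReal (18 / ((ε / (1 + 2 * ε)) ^ 4 * (n : ℝ) ^ 2)) := by
  obtain ⟨κ, hκ, hDP, hcond⟩ := hP
  have hx : AEMeasurable x μ := hcond.aemeasurable_fst
  have : IsProbabilityMeasure (μ.map x) := Measure.isProbabilityMeasure_map hx
  have hbase : Measurable fun v : Fin n → S => (posteriorBase a H v).real A := by
    simp only [posteriorBase_real_apply ha H _ hA]
    have : ∀ i : Fin n, Measurable fun v : Fin n → S => A.indicator (fun _ => (1 : ℝ)) (v i) :=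
      fun i => (measurable_const.indicator hA).comp (measurable_pi_apply i)
    fun_prop
  have hE : MeasurableSet {p : (Fin n → S) × ProbabilityMeasure S |
      ε ≤ |(p.2 : Measure S).real A - (posteriorBase a H p.1).real A|} := by
    refine measurableSet_le measurable_const ?_
    exact (((measurable_probabilityMeasure_real hA).comp measurable_snd).sub
      (hbase.comp measurable_fst)).abs
  have hlaw := hcond.map_eq
  calc μ {ω | ε ≤ |(P ω : Measure S).real A - (posteriorBase a H (x ω)).real A|}
      = ((μ.map x) ⊗ₘ κ) {p | ε ≤ |(p.2 : Measure S).real A - (posteriorBase a H p.1).real A|} := by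
        rw [← hlaw, Measure.map_apply_of_aemeasurable hcond.aemeasurable hE]
        rfl
    _ = ∫⁻ v, κ v {R | ε ≤ |(R : Measure S).real A - (posteriorBase a H v).real A|}
          ∂(μ.map x) := Measure.compProd_apply hE
    _ ≤ ∫⁻ _, ENNReal.ofReal (18 / ((ε / (1 + 2 * ε)) ^ 4 * (n : ℝ) ^ 2)) ∂(μ.map x) := by
        refine lintegral_mono_ae ?_
        filter_upwards [hDP] with v hv
        have := isProbabilityMeasure_posteriorBase ha H v
        have hn' : (1 : ℝ) ≤ n := by exact_mod_cast hn
        rw [← ofReal_measureReal]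
        refine ENNReal.ofReal_le_ofReal ((hv.tail_le (by linarith) hA hε).trans ?_)
        gcongr
        linarith
    _ = _ := by simp

/-- Borel–Cantelli: the masses that the posterior process and its base measure give to `A` are
asymptotically equal almost surely, whatever the joint law of the posterior processes. -/
theorem IsDirichletPosterior.ae_tendsto_sub {S Ω : Type*} [MeasurableSpace S] [MeasurableSpace Ω]
    {μ : Measure Ω}
    [IsProbabilityMeasure μ] {a : ℝ} (ha : 0 < a) {H : Measure S} [IsProbabilityMeasure H]
    {x : (n : ℕ) → Ω → Fin n → S} {P : ℕ → Ω → ProbabilityMeasure S}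
    (hP : ∀ n, IsDirichletPosterior a H (x n) (P n) μ) {A : Set S} (hA : MeasurableSet A) :
    ∀ᵐ ω ∂μ, Tendsto (fun n => (P n ω : Measure S).real A - (posteriorBase a H (x n ω)).real A)
      atTop (𝓝 0) := by
  have hev : ∀ k : ℕ, ∀ᵐ ω ∂μ, ∀ᶠ n in atTop,
      |(P n ω : Measure S).real A - (posteriorBase a H (x n ω)).real A| < 1 / ((k : ℝ) + 1) := by
    intro k
    have hε : (0 : ℝ) < 1 / (k + 1) := by positivity
    obtain ⟨ε, hεk⟩ : ∃ ε : ℝ, 1 / ((k : ℝ) + 1) = ε := ⟨_, rfl⟩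
    rw [hεk] at hε ⊢
    have hsum : Summable fun n : ℕ =>
        18 / ((ε / (1 + 2 * ε)) ^ 4 * ((n + 1 : ℕ) : ℝ) ^ 2) := by
      have := ((summable_nat_add_iff 1).2
        (Real.summable_one_div_nat_pow.2 one_lt_two)).mul_left (18 / (ε / (1 + 2 * ε)) ^ 4)
      refine this.congr fun n => ?_
      rw [div_mul_div_comm, mul_one]
    -- The tail bound needs a sample of size at least `1`, hence the shift of the index.
    have hfin : ∑' n, μ {ω | ε ≤ |(P (n + 1) ω : Measure S).real A
        - (posteriorBase a H (x (n + 1) ω)).real A|} ≠ ⊤ :=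
      ne_top_of_le_ne_top hsum.tsum_ofReal_ne_top
        (ENNReal.tsum_le_tsum fun n => (hP (n + 1)).tail_le ha (Nat.le_add_left 1 n) hA hε)
    filter_upwards [ae_eventually_notMem hfin] with ω hω
    rw [← map_add_atTop_eq_nat 1, eventually_map]
    filter_upwards [hω] with n hn
    simpa using hn
  filter_upwards [ae_all_iff.2 hev] with ω hω
  rw [Metric.tendsto_nhds]
  intro ε hε
  obtain ⟨k, hk⟩ := exists_nat_one_div_lt hε
  filter_upwards [hω k] with n hn
  rw [Real.dist_0_eq_abs]
  exact hn.trans hk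

/-- The strong law of large numbers for the indicators of `A`; the prior is negligible. -/
theorem ae_tendsto_posteriorBase {S Ω : Type*} [MeasurableSpace S] [MeasurableSpace Ω]
    {μ : Measure Ω}
    [IsProbabilityMeasure μ] {a : ℝ} (ha : 0 < a) {H : Measure S} [IsProbabilityMeasure H]
    {F : Measure S} [IsProbabilityMeasure F] {X : ℕ → Ω → S} (hX : ∀ i, HasLaw (X i) F μ)
    (hXindep : iIndepFun X μ) {A : Set S} (hA : MeasurableSet A) :
    ∀ᵐ ω ∂μ, Tendsto (fun n : ℕ => (posteriorBase a H fun i : Fin n => X i ω).real A)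
      atTop (𝓝 (F.real A)) := by
  have hg : Measurable (A.indicator fun _ => (1 : ℝ)) := measurable_const.indicator hA
  have hlaw : ∀ i, HasLaw (A.indicator (fun _ => (1 : ℝ)) ∘ X i) (F.map (A.indicator fun _ => 1))
      μ := fun i => HasLaw.comp ⟨hg.aemeasurable, rfl⟩ (hX i)
  have hint : Integrable (A.indicator (fun _ => (1 : ℝ)) ∘ X 0) μ := by
    refine Integrable.of_bound (C := 1) (hlaw 0).aemeasurable.aestronglyMeasurable
      (ae_of_all _ fun ω => ?_)
    by_cases h : X 0 ω ∈ A <;> simp [h]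
  have hslln := strong_law_ae_real (μ := μ) (fun i => A.indicator (fun _ => (1 : ℝ)) ∘ X i) hint
    (fun i j hij => (hXindep.indepFun hij).comp hg hg)
    (fun i => (hlaw i).identDistrib (hlaw 0))
  have hmean : μ[A.indicator (fun _ => (1 : ℝ)) ∘ X 0] = F.real A := by
    rw [(hX 0).integral_comp hg.aestronglyMeasurable, integral_indicator_const _ hA]
    simp
  rw [hmean] at hslln
  filter_upwards [hslln] with ω hω
  simp only [posteriorBase_real_apply ha H _ hA]
  have h₁ : Tendsto (fun n : ℕ => a * H.real A / (a + n)) atTop (𝓝 0) :=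
    tendsto_const_nhds.div_atTop (tendsto_const_nhds.add_atTop tendsto_natCast_atTop_atTop)
  have h₂ := h₁.add (hω.mul (tendsto_natCast_div_add_atTop a))
  rw [zero_add, mul_one] at h₂
  refine h₂.congr fun n => ?_
  rw [Finset.sum_range, add_div, add_comm (n : ℝ) a]
  rcases n.eq_zero_or_pos with rfl | hn
  · simp
  · congr 1
    simp only [Function.comp_apply]
    field_simp

theorem IsDirichletPosterior.ae_tendsto {S Ω : Type*} [MeasurableSpace S] [MeasurableSpace Ω]
    {μ : Measure Ω}
    [IsProbabilityMeasure μ] {a : ℝ} (ha : 0 < a) {H : Measure S} [IsProbabilityMeasure H]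
    {F : Measure S} [IsProbabilityMeasure F] {X : ℕ → Ω → S} (hX : ∀ i, HasLaw (X i) F μ)
    (hXindep : iIndepFun X μ) {P : ℕ → Ω → ProbabilityMeasure S}
    (hP : ∀ n, IsDirichletPosterior a H (fun ω (i : Fin n) => X i ω) (P n) μ)
    {A : Set S} (hA : MeasurableSet A) :
    ∀ᵐ ω ∂μ, Tendsto (fun n => (P n ω : Measure S).real A) atTop (𝓝 (F.real A)) := by
  filter_upwards [ae_tendsto_sub ha hP hA, ae_tendsto_posteriorBase ha (H := H) hX hXindep hA]
    with ω h₁ h₂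
  simpa using h₁.add h₂

theorem IsDirichletPosterior.ae_tendsto_cdf {Ω : Type*} [MeasurableSpace Ω] {μ : Measure Ω}
    [IsProbabilityMeasure μ] {a : ℝ} (ha : 0 < a) {H : Measure ℝ} [IsProbabilityMeasure H]
    {F : Measure ℝ} [IsProbabilityMeasure F] {X : ℕ → Ω → ℝ} (hX : ∀ i, HasLaw (X i) F μ)
    (hXindep : iIndepFun X μ) {P : ℕ → Ω → ProbabilityMeasure ℝ}
    (hP : ∀ n, IsDirichletPosterior a H (fun ω (i : Fin n) => X i ω) (P n) μ) :
    ∀ᵐ ω ∂μ, ∀ q : ℚ, Tendsto (fun n => cdf (P n ω) q) atTop (𝓝 (cdf F q)) := by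
  rw [ae_all_iff]
  intro q
  simp only [cdf_eq_real]
  exact IsDirichletPosterior.ae_tendsto ha hX hXindep hP measurableSet_Iic

/-! ### Continuity of the Cramér–von Mises distance -/

theorem exists_rat_btwn_cdf_sub_lt {F : Measure ℝ} (hF : Continuous (cdf F))
    {ε : ℝ} (hε : 0 < ε) (x : ℝ) :
    ∃ q r : ℚ, (q : ℝ) < x ∧ x < r ∧ cdf F r - cdf F q < ε := by
  obtain ⟨δ, hδ, h⟩ := Metric.continuousAt_iff.1 (hF.continuousAt (x := x)) (ε / 2) (half_pos hε)
  obtain ⟨q, hq, hqx⟩ := exists_rat_btwn (sub_lt_self x hδ)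
  obtain ⟨r, hxr, hr⟩ := exists_rat_btwn (lt_add_of_pos_right x hδ)
  refine ⟨q, r, hqx, hxr, ?_⟩
  have h1 := h (show dist (q : ℝ) x < δ by rw [Real.dist_eq, abs_lt]; constructor <;> linarith)
  have h2 := h (show dist (r : ℝ) x < δ by rw [Real.dist_eq, abs_lt]; constructor <;> linarith)
  rw [Real.dist_eq, abs_lt] at h1 h2
  linarith [h1.1, h2.2]

/-- **Pólya's theorem**: convergence of distribution functions on a dense set to a continuous
distribution function is uniform. By monotonicity it is uniform near each point; compactness deals
with a bounded interval, and outside it the limits `0` and `1` at infinity do. -/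
theorem tendstoUniformly_cdf {ι : Type*} {l : Filter ι} {F : Measure ℝ}
    (hF : Continuous (cdf F)) {P : ι → Measure ℝ}
    (h : ∀ q : ℚ, Tendsto (fun n => cdf (P n) q) l (𝓝 (cdf F q))) :
    TendstoUniformly (fun n t => cdf (P n) t) (cdf F) l := by
  rw [Metric.tendstoUniformly_iff]
  intro ε hε
  have hε2 := half_pos hε
  obtain ⟨A, hA⟩ := ((tendsto_cdf_atBot F).eventually (gt_mem_nhds hε2)).exists
  obtain ⟨B, hB⟩ := ((tendsto_cdf_atTop F).eventually
    (lt_mem_nhds (sub_lt_self (1 : ℝ) hε2))).exists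
  obtain ⟨q, hq⟩ := exists_rat_lt A
  obtain ⟨r, hr⟩ := exists_rat_gt B
  have hclose : ∀ s : ℚ, ∀ᶠ n in l, dist (cdf (P n) s) (cdf F s) < ε / 2 := fun s =>
    Metric.tendsto_nhds.1 (h s) _ hε2
  have hmid : ∀ᶠ n in l, ∀ t ∈ Set.Icc (q : ℝ) r, dist (cdf F t) (cdf (P n) t) < ε := by
    refine isCompact_Icc.induction_on (p := fun s => ∀ᶠ n in l, ∀ t ∈ s,
      dist (cdf F t) (cdf (P n) t) < ε) (by simp) ?_ ?_ ?_
    · intro s t hst ht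
      filter_upwards [ht] with n hn u hu using hn u (hst hu)
    · intro s t hs ht
      filter_upwards [hs, ht] with n hn₁ hn₂ u hu using hu.elim (hn₁ u) (hn₂ u)
    · intro x _
      obtain ⟨a, b, hax, hxb, hab⟩ := exists_rat_btwn_cdf_sub_lt hF hε2 x
      refine ⟨Set.Icc a b, mem_nhdsWithin_of_mem_nhds (Icc_mem_nhds hax hxb), ?_⟩
      filter_upwards [hclose a, hclose b] with n ha hb t ht
      rw [Real.dist_eq, abs_lt] at ha hb ⊢
      have m1 := monotone_cdf F ht.1
      have m2 := monotone_cdf F ht.2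
      have m3 := monotone_cdf (P n) ht.1
      have m4 := monotone_cdf (P n) ht.2
      constructor <;> linarith [ha.1, ha.2, hb.1, hb.2]
  filter_upwards [hmid, hclose q, hclose r] with n hn hq' hr' t
  rw [Real.dist_eq, abs_lt] at hq' hr'
  rcases le_total t q with htq | hqt
  · have m1 := monotone_cdf F htq
    have m2 := monotone_cdf (P n) htq
    have m3 := monotone_cdf F hq.le
    rw [Real.dist_eq, abs_lt]
    constructor <;> linarith [hq'.1, hq'.2, cdf_nonneg F t, cdf_nonneg (P n) t]
  rcases le_total t r with htr | hrt
  · exact hn t ⟨hqt, htr⟩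
  · have m1 := monotone_cdf F hrt
    have m2 := monotone_cdf (P n) hrt
    have m3 := monotone_cdf F hr.le
    rw [Real.dist_eq, abs_lt]
    constructor <;> linarith [hr'.1, hr'.2, cdf_le_one F t, cdf_le_one (P n) t]

/-- Convergence of the distribution functions at the rationals implies weak convergence, since the
intervals `Ioc q r` with rational end points form a π-system containing small neighbourhoods of
every point. -/
theorem tendsto_of_tendsto_cdf_rat {ι : Type*} {l : Filter ι} [l.IsCountablyGenerated]
    {G : ProbabilityMeasure ℝ} {Q : ι → ProbabilityMeasure ℝ}
    (h : ∀ q : ℚ, Tendsto (fun n => cdf (Q n) q) l (𝓝 (cdf G q))) :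
    Tendsto Q l (𝓝 G) := by
  refine (isPiSystem_Ioc (fun q : ℚ => (q : ℝ))
    (fun q : ℚ => (q : ℝ))).tendsto_probabilityMeasure_of_tendsto_of_mem ?_ ?_ ?_
  · rintro _ ⟨q, r, _, rfl⟩
    exact measurableSet_Ioc
  · intro u hu x hx
    obtain ⟨a, b, hab, hsub⟩ := mem_nhds_iff_exists_Ioo_subset.1 (hu.mem_nhds hx)
    obtain ⟨q, haq, hqx⟩ := exists_rat_btwn hab.1
    obtain ⟨r, hxr, hrb⟩ := exists_rat_btwn hab.2
    exact ⟨Set.Ioc q r, ⟨q, r, hqx.trans hxr, rfl⟩, Ioc_mem_nhds hqx hxr,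
      fun y hy => hsub ⟨haq.trans hy.1, hy.2.trans_lt hrb⟩⟩
  · rintro _ ⟨q, r, hqr, rfl⟩
    have e : ∀ R : ProbabilityMeasure ℝ,
        ((R (Set.Ioc (q : ℝ) r) : NNReal) : ℝ) = cdf R r - cdf R q := by
      intro R
      rw [cdf_eq_real, cdf_eq_real, ← measureReal_sdiff (Set.Iic_subset_Iic.2 hqr.le)
        measurableSet_Iic, Set.Iic_sdiff_Iic]
      rfl
    rw [← NNReal.tendsto_coe]
    simp only [e]
    exact (h r).sub (h q)

theorem abs_sq_sub_sq_le {a b c d : ℝ} (ha : a ∈ Set.Icc (0 : ℝ) 1) (hb : b ∈ Set.Icc (0 : ℝ) 1)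
    (hc : c ∈ Set.Icc (0 : ℝ) 1) (hd : d ∈ Set.Icc (0 : ℝ) 1) :
    |(a - b) ^ 2 - (c - d) ^ 2| ≤ 2 * (|a - c| + |b - d|) := by
  have e : (a - b) ^ 2 - (c - d) ^ 2 = ((a - b) + (c - d)) * ((a - c) - (b - d)) := by ring
  rw [e, abs_mul]
  refine mul_le_mul ?_ (abs_sub _ _) (abs_nonneg _) zero_le_two
  rw [abs_le]
  constructor <;> linarith [ha.1, ha.2, hb.1, hb.2, hc.1, hc.2, hd.1, hd.2]

theorem cdf_mem_Icc (R : Measure ℝ) (t : ℝ) : cdf R t ∈ Set.Icc (0 : ℝ) 1 :=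
  ⟨cdf_nonneg R t, cdf_le_one R t⟩

theorem integrable_sq_cdf_sub (R S : Measure ℝ) (Q : Measure ℝ) [IsFiniteMeasure Q] :
    Integrable (fun t => (cdf R t - cdf S t) ^ 2) Q := by
  refine Integrable.of_bound (C := 1) ?_ (ae_of_all _ fun t => ?_)
  · exact (((monotone_cdf R).measurable.sub (monotone_cdf S).measurable).pow_const
      2).aestronglyMeasurable
  · rw [Real.norm_eq_abs, abs_pow]
    refine pow_le_one₀ (abs_nonneg _) ?_
    have h1 := cdf_mem_Icc R t
    have h2 := cdf_mem_Icc S t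
    rw [abs_le]
    constructor <;> linarith [h1.1, h1.2, h2.1, h2.2]

/-- Continuity of the Cramér–von Mises distance: the integrand converges uniformly, and the
integrating measure converges weakly, the limit integrand being continuous. -/
theorem tendsto_cvmDist {ι : Type*} {l : Filter ι} [l.IsCountablyGenerated]
    {F G : Measure ℝ} [IsProbabilityMeasure F] [IsProbabilityMeasure G]
    (hF : Continuous (cdf F)) (hG : Continuous (cdf G)) {P Q : ι → ProbabilityMeasure ℝ}
    (hP : ∀ q : ℚ, Tendsto (fun n => cdf (P n) q) l (𝓝 (cdf F q)))
    (hQ : ∀ q : ℚ, Tendsto (fun n => cdf (Q n) q) l (𝓝 (cdf G q))) :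
    Tendsto (fun n => cvmDist (P n) (Q n)) l (𝓝 (cvmDist F G)) := by
  have hweak : Tendsto (fun n => ∫ t, (cdf F t - cdf G t) ^ 2 ∂(Q n : Measure ℝ)) l
      (𝓝 (cvmDist F G)) := by
    have hQG : Tendsto Q l (𝓝 (⟨G, inferInstance⟩ : ProbabilityMeasure ℝ)) :=
      tendsto_of_tendsto_cdf_rat hQ
    refine ProbabilityMeasure.tendsto_iff_forall_integral_tendsto.1 hQG
      (BoundedContinuousFunction.ofNormedAddCommGroup (fun t => (cdf F t - cdf G t) ^ 2)
        (by fun_prop) 1 fun t => ?_)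
    rw [Real.norm_eq_abs, abs_pow]
    refine pow_le_one₀ (abs_nonneg _) ?_
    have h1 := cdf_mem_Icc F t
    have h2 := cdf_mem_Icc G t
    rw [abs_le]
    constructor <;> linarith [h1.1, h1.2, h2.1, h2.2]
  refine tendsto_of_tendsto_of_dist hweak ?_
  rw [Metric.tendsto_nhds]
  intro ε hε
  filter_upwards [Metric.tendstoUniformly_iff.1 (tendstoUniformly_cdf hF hP) (ε / 5) (by positivity),
    Metric.tendstoUniformly_iff.1 (tendstoUniformly_cdf hG hQ) (ε / 5) (by positivity)]
    with n hn₁ hn₂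
  have hle : dist (∫ t, (cdf F t - cdf G t) ^ 2 ∂(Q n : Measure ℝ)) (cvmDist (P n) (Q n))
      ≤ 4 * (ε / 5) := by
    rw [cvmDist, dist_eq_norm, ← integral_sub (integrable_sq_cdf_sub _ _ _)
      (integrable_sq_cdf_sub _ _ _)]
    refine (norm_integral_le_of_norm_le_const (C := 4 * (ε / 5)) (ae_of_all _ fun t => ?_)).trans ?_
    · refine (abs_sq_sub_sq_le (cdf_mem_Icc _ _) (cdf_mem_Icc _ _) (cdf_mem_Icc _ _)
        (cdf_mem_Icc _ _)).trans ?_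
      have h1 := hn₁ t
      have h2 := hn₂ t
      rw [Real.dist_eq] at h1 h2
      linarith
    · simp
  rw [Real.dist_0_eq_abs, abs_of_nonneg dist_nonneg]
  linarith

/-! ### Consistency of the posterior distance -/

theorem mainTheorem3 {Ω : Type*} [MeasurableSpace Ω] (μ : Measure Ω) [IsProbabilityMeasure μ]
    (F G : Measure ℝ) [IsProbabilityMeasure F] [IsProbabilityMeasure G]
    (hF : Continuous (cdf F)) (hG : Continuous (cdf G))
    (a₁ a₂ : ℝ) (ha₁ : 0 < a₁) (ha₂ : 0 < a₂)
    (H₁ H₂ : Measure ℝ) [IsProbabilityMeasure H₁] [IsProbabilityMeasure H₂]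
    (X Y : ℕ → Ω → ℝ)
    (hX : ∀ i, HasLaw (X i) F μ) (hXindep : iIndepFun X μ)
    (hY : ∀ j, HasLaw (Y j) G μ) (hYindep : iIndepFun Y μ)
    (hXY : IndepFun (fun ω i => X i ω) (fun ω j => Y j ω) μ)
    (P Q : ℕ → Ω → ProbabilityMeasure ℝ)
    (hP : ∀ n, IsDirichletPosterior a₁ H₁ (fun ω (i : Fin n) => X i ω) (P n) μ)
    (hQ : ∀ n, IsDirichletPosterior a₂ H₂ (fun ω (j : Fin n) => Y j ω) (Q n) μ) :
    ∀ᵐ ω ∂μ, Tendsto (fun n : ℕ × ℕ => cvmDist (P n.1 ω) (Q n.2 ω))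
      (atTop ×ˢ atTop) (𝓝 (cvmDist F G)) := by
  filter_upwards [IsDirichletPosterior.ae_tendsto_cdf ha₁ hX hXindep hP,
    IsDirichletPosterior.ae_tendsto_cdf ha₂ hY hYindep hQ] with ω hPω hQω
  exact tendsto_cvmDist hF hG (P := fun n : ℕ × ℕ => P n.1 ω) (Q := fun n : ℕ × ℕ => Q n.2 ω)
    (fun q => (hPω q).comp tendsto_fst) (fun q => (hQω q).comp tendsto_snd)
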